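/- Let $(X,\mathsf d)$ be a complete separable metric space and $\mathfrak m\ge 0$ a Borel measure on $X$ that is finite on balls. Let $W^{1,2}(X)$ be the Sobolev space of ($\mathfrak m$-a.e. equivalence classes of) real-valued functions $f\in L^2(\mathfrak m)$ that have a representative with an upper gradient in $L^2(\mathfrak m)$, with norm $\|f\|_{W^{1,2}}^2=\|f\|_{L^2(\mathfrak m)}^2+\||Df|\|_{L^2(\mathfrak m)}^2$, where $|Df|$ is the minimal weak upper gradient, so that $\||Df|\|_{L^2(\mathfrak m)}^2$ is the infimum of $\int g^2\,d\mathfrak m$ over all upper gradients $g$ of representatives of $f$. For $E\subset X$ let $$\mathrm{Cap}(E):=\inf\big\{\|f\|_{W^{1,2}}^2 : f\in W^{1,2}(X),\ f\ge 1\ \mathfrak m\text{-a.e. on some open neighbourhood of }E\big\}\in[0,\infty],$$ where $\inf\emptyset=+\infty$. Let $L^0(\mathrm{Cap})$ be the space of Borel functions $X\to\mathbb R$ up to equality outside a set of zero capacity, and let $\mathrm{Pr}:L^0(\mathrm{Cap})\to L^0(\mathfrak m)$ be the projection $[f]_{\mathrm{Cap}}\mapsto[f]_{\mathfrak m}$.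 A function $f:X\to\mathbb R$ is quasi-continuous if for every $\varepsilon>0$ there is $E\subset X$ with $\mathrm{Cap}(E)<\varepsilon$ such that $f|_{X\setminus E}$ is continuous; $\mathcal{QC}(X)\subset L^0(\mathrm{Cap})$ is the linear space of classes of quasi-continuous functions. It is equipped with the distance $$\mathsf d_{\mathcal{QU}}(f,g):=\inf_{E\subset X}\sum_{k\in\mathbb N}\bigg(\frac{\mathrm{Cap}(E\cap A_k)}{2^k(\mathrm{Cap}(A_k)\vee 1)}+\frac1{2^k}\sup_{x\in A_k\setminus E}|f(x)-g(x)|\wedge 1\bigg),$$ where $(A_k)_k$ is any increasing sequence of open sets of finite capacity such that every bounded subset of $X$ is contained in some $A_k$. Borel functions $f_n$ converge locally quasi-uniformly to $f$ if for every bounded $B\subset X$ and every $\varepsilon>0$ there is $E\subset X$ with $\mathrm{Cap}(E)<\varepsilon$ such that $f_n\to f$ uniformly on $B\setminus E$. Suppose that the classes of continuous functions that belong to $W^{1,2}(X)$ are dense in $W^{1,2}(X)$. Then there exists a unique continuous map $$\mathsf{QCR}:W^{1,2}(X)\to\mathcal{QC}(X)$$ such that $\mathrm{Pr}\circ\mathsf{QCR}$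 is the inclusion $W^{1,2}(X)\subset L^0(\mathfrak m)$; this map does not depend on the choice of $(A_k)_k$. Moreover, $\mathsf{QCR}$ is linear and satisfies $|\mathsf{QCR}(f)|=\mathsf{QCR}(|f|)$ $\mathrm{Cap}$-a.e. for every $f\in W^{1,2}(X)$. Finally, if $f_n\to f$ in $W^{1,2}(X)$, then every subsequence of $(\mathsf{QCR}(f_n))_n$ has a further subsequence that converges locally quasi-uniformly to $\mathsf{QCR}(f)$. -/

import Mathlib

open MeasureTheory Set Filter Topology
open scoped ENNReal

namespace QCSobolev

variable {X : Type*} [MetricSpace X] [MeasurableSpace X]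

/-! ### Upper gradients and the Sobolev space -/

/-- `g` is an upper gradient of `f`: along every rectifiable curve, which we take parametrized by
arc length on `[0, L]`, the increment of `f` is at most the line integral of `g`. -/
def IsUpperGradient (f : X → ℝ) (g : X → ℝ≥0∞) : Prop :=
  Measurable g ∧ ∀ (L : ℝ) (γ : ℝ → X), 0 ≤ L → HasUnitSpeedOn γ (Icc 0 L) →
    ENNReal.ofReal |f (γ 0) - f (γ L)| ≤ ∫⁻ t in Icc 0 L, g (γ t)

/-- The infimum of `∫ g²` over the upper gradients `g` of all representatives of `F`. This is
`∫ |DF|²` for the minimal weak upper gradient `|DF|`, and it is `∞` if there is none in `L²`. -/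
noncomputable def energy (m : Measure X) (F : X →ₘ[m] ℝ) : ℝ≥0∞ :=
  ⨅ (f : X → ℝ) (_ : f =ᵐ[m] F) (g : X → ℝ≥0∞) (_ : IsUpperGradient f g), ∫⁻ x, g x ^ 2 ∂m

/-- The squared Sobolev norm `‖F‖²_{L²} + ‖|DF|‖²_{L²}`, with value `∞` off the Sobolev space. -/
noncomputable def sobolevNormSq (m : Measure X) (F : X →ₘ[m] ℝ) : ℝ≥0∞ :=
  (∫⁻ x, ‖F x‖ₑ ^ 2 ∂m) + energy m F

theorem sobolevNormSq_le {m : Measure X} {F : X →ₘ[m] ℝ} {f : X → ℝ} (hf : f =ᵐ[m] F)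
    {g : X → ℝ≥0∞} (hg : IsUpperGradient f g) :
    sobolevNormSq m F ≤ (∫⁻ x, ‖f x‖ₑ ^ 2 ∂m) + ∫⁻ x, g x ^ 2 ∂m := by
  have h1 : ∫⁻ x, ‖F x‖ₑ ^ 2 ∂m = ∫⁻ x, ‖f x‖ₑ ^ 2 ∂m :=
    lintegral_congr_ae (hf.mono fun x hx => by simp only [hx])
  have h2 : energy m F ≤ ∫⁻ x, g x ^ 2 ∂m :=
    (iInf₂_le f hf).trans (iInf₂_le g hg)
  rw [sobolevNormSq, h1]
  gcongr

theorem exists_of_sobolevNormSq_lt {m : Measure X} {F : X →ₘ[m] ℝ} {c : ℝ≥0∞}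
    (h : sobolevNormSq m F < c) :
    ∃ (f : X → ℝ) (g : X → ℝ≥0∞), f =ᵐ[m] F ∧ IsUpperGradient f g ∧
      (∫⁻ x, ‖f x‖ₑ ^ 2 ∂m) + ∫⁻ x, g x ^ 2 ∂m < c := by
  have h' : energy m F < c - ∫⁻ x, ‖F x‖ₑ ^ 2 ∂m := by
    rw [lt_tsub_iff_left]; exact h
  simp only [energy, iInf_lt_iff] at h'
  obtain ⟨f, hf, g, hg, hlt⟩ := h'
  refine ⟨f, g, hf, hg, ?_⟩
  have h1 : ∫⁻ x, ‖F x‖ₑ ^ 2 ∂m = ∫⁻ x, ‖f x‖ₑ ^ 2 ∂m :=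
    lintegral_congr_ae (hf.mono fun x hx => by simp only [hx])
  rw [← h1]
  exact lt_tsub_iff_left.1 hlt

theorem isUpperGradient_zero : IsUpperGradient (fun _ : X => (0 : ℝ)) 0 :=
  ⟨measurable_const, fun L γ _ _ => by simp⟩

theorem IsUpperGradient.add {f₁ f₂ : X → ℝ} {g₁ g₂ : X → ℝ≥0∞} (h₁ : IsUpperGradient f₁ g₁)
    (h₂ : IsUpperGradient f₂ g₂) : IsUpperGradient (f₁ + f₂) (g₁ + g₂) := by
  refine ⟨h₁.1.add h₂.1, fun L γ hL hγ => ?_⟩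
  calc ENNReal.ofReal |(f₁ + f₂) (γ 0) - (f₁ + f₂) (γ L)|
      ≤ ENNReal.ofReal (|f₁ (γ 0) - f₁ (γ L)| + |f₂ (γ 0) - f₂ (γ L)|) := by
        apply ENNReal.ofReal_le_ofReal
        simp only [Pi.add_apply, add_sub_add_comm]
        exact abs_add_le _ _
    _ ≤ ENNReal.ofReal |f₁ (γ 0) - f₁ (γ L)| + ENNReal.ofReal |f₂ (γ 0) - f₂ (γ L)| :=
        ENNReal.ofReal_add_le
    _ ≤ (∫⁻ t in Icc 0 L, g₁ (γ t)) + ∫⁻ t in Icc 0 L, g₂ (γ t) :=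
        add_le_add (h₁.2 L γ hL hγ) (h₂.2 L γ hL hγ)
    _ ≤ ∫⁻ t in Icc 0 L, (g₁ + g₂) (γ t) := le_lintegral_add _ _

/-- A function whose increments are controlled by those of `f` inherits the upper gradients. -/
theorem IsUpperGradient.of_le {f f' : X → ℝ} {g : X → ℝ≥0∞} (h : IsUpperGradient f g)
    (hf : ∀ x y, |f' x - f' y| ≤ |f x - f y|) : IsUpperGradient f' g :=
  ⟨h.1, fun L γ hL hγ => (ENNReal.ofReal_le_ofReal (hf _ _)).trans (h.2 L γ hL hγ)⟩

theorem IsUpperGradient.const_mul {f : X → ℝ} {g : X → ℝ≥0∞} (h : IsUpperGradient f g) (c : ℝ) :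
    IsUpperGradient (fun x => c * f x) (fun x => ENNReal.ofReal |c| * g x) := by
  refine ⟨h.1.const_mul _, fun L γ hL hγ => ?_⟩
  rw [lintegral_const_mul' _ _ ENNReal.ofReal_ne_top, ← mul_sub, abs_mul,
    ENNReal.ofReal_mul (abs_nonneg c)]
  gcongr
  exact h.2 L γ hL hγ

/-- The Sobolev space `W^{1,2}(X, d, m)`, a space of `m`-a.e. equivalence classes. -/
noncomputable def W12 (m : Measure X) : Submodule ℝ (X →ₘ[m] ℝ) where
  carrier := {F | sobolevNormSq m F < ∞}
  zero_mem' := by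
    have h0 : (fun _ : X => (0 : ℝ)) =ᵐ[m] (0 : X →ₘ[m] ℝ) := AEEqFun.coeFn_zero.symm
    refine (sobolevNormSq_le h0 isUpperGradient_zero).trans_lt ?_
    simp
  add_mem' := by
    intro F G hF hG
    obtain ⟨f, g, hf, hg, h⟩ := exists_of_sobolevNormSq_lt hF
    obtain ⟨f', g', hf', hg', h'⟩ := exists_of_sobolevNormSq_lt hG
    have hs : f + f' =ᵐ[m] ((F + G : X →ₘ[m] ℝ) : X → ℝ) :=
      (hf.add hf').trans (AEEqFun.coeFn_add F G).symm
    refine (sobolevNormSq_le hs (hg.add hg')).trans_lt ?_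
    have key : ∀ a b : ℝ≥0∞, (a + b) ^ 2 ≤ 4 * a ^ 2 + 4 * b ^ 2 := by
      intro a b
      rcases le_total a b with hab | hab
      · calc (a + b) ^ 2 ≤ (b + b) ^ 2 := by gcongr
          _ = 4 * b ^ 2 := by ring
          _ ≤ _ := le_add_self
      · calc (a + b) ^ 2 ≤ (a + a) ^ 2 := by gcongr
          _ = 4 * a ^ 2 := by ring
          _ ≤ _ := le_self_add
    have hfm : AEMeasurable f m := F.aemeasurable.congr hf.symm
    obtain ⟨h1, h2⟩ := ENNReal.add_lt_top.1 h
    obtain ⟨h1', h2'⟩ := ENNReal.add_lt_top.1 h'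
    refine ENNReal.add_lt_top.2 ⟨?_, ?_⟩
    · calc ∫⁻ x, ‖(f + f') x‖ₑ ^ 2 ∂m ≤ ∫⁻ x, (4 * ‖f x‖ₑ ^ 2 + 4 * ‖f' x‖ₑ ^ 2) ∂m :=
            lintegral_mono fun x => (pow_le_pow_left' (enorm_add_le _ _) 2).trans (key _ _)
        _ = 4 * (∫⁻ x, ‖f x‖ₑ ^ 2 ∂m) + 4 * ∫⁻ x, ‖f' x‖ₑ ^ 2 ∂m := by
            rw [lintegral_add_left' ((hfm.enorm.pow_const 2).const_mul 4),
              lintegral_const_mul' _ _ (by simp), lintegral_const_mul' _ _ (by simp)]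
        _ < ∞ := ENNReal.add_lt_top.2
            ⟨ENNReal.mul_lt_top (by simp) h1, ENNReal.mul_lt_top (by simp) h1'⟩
    · calc ∫⁻ x, (g + g') x ^ 2 ∂m ≤ ∫⁻ x, (4 * g x ^ 2 + 4 * g' x ^ 2) ∂m :=
            lintegral_mono fun x => key _ _
        _ = 4 * (∫⁻ x, g x ^ 2 ∂m) + 4 * ∫⁻ x, g' x ^ 2 ∂m := by
            rw [lintegral_add_left ((hg.1.pow_const 2).const_mul 4),
              lintegral_const_mul' _ _ (by simp), lintegral_const_mul' _ _ (by simp)]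
        _ < ∞ := ENNReal.add_lt_top.2
            ⟨ENNReal.mul_lt_top (by simp) h2, ENNReal.mul_lt_top (by simp) h2'⟩
  smul_mem' := by
    intro c F hF
    obtain ⟨f, g, hf, hg, h⟩ := exists_of_sobolevNormSq_lt hF
    have hs : (fun x => c * f x) =ᵐ[m] ((c • F : X →ₘ[m] ℝ) : X → ℝ) := by
      filter_upwards [hf, AEEqFun.coeFn_smul c F] with x hx hx'
      rw [hx', Pi.smul_apply, hx, smul_eq_mul]
    refine (sobolevNormSq_le hs (hg.const_mul c)).trans_lt ?_
    obtain ⟨h1, h2⟩ := ENNReal.add_lt_top.1 h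
    simp only [enorm_mul, mul_pow]
    rw [lintegral_const_mul' _ _ (by simp), lintegral_const_mul' _ _ (by simp)]
    exact ENNReal.add_lt_top.2 ⟨ENNReal.mul_lt_top (by simp) h1, ENNReal.mul_lt_top (by simp) h2⟩

/-- The norm of `W^{1,2}`. -/
noncomputable def sobolevNorm {m : Measure X} (F : W12 m) : ℝ :=
  Real.sqrt (sobolevNormSq m F).toReal

/-- The absolute value of a Sobolev function, again a Sobolev function. -/
noncomputable def sobolevAbs {m : Measure X} (F : W12 m) : W12 m :=
  ⟨|(F : X →ₘ[m] ℝ)|, by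
    obtain ⟨f, g, hf, hg, h⟩ := exists_of_sobolevNormSq_lt (show sobolevNormSq m F.1 < ∞ from F.2)
    have hs : (fun x => |f x|) =ᵐ[m] ((|(F : X →ₘ[m] ℝ)| : X →ₘ[m] ℝ) : X → ℝ) := by
      filter_upwards [hf, AEEqFun.coeFn_abs (F : X →ₘ[m] ℝ)] with x hx hx'
      rw [hx', hx]
    refine (sobolevNormSq_le hs (hg.of_le fun x y => abs_abs_sub_abs_le _ _)).trans_lt ?_
    simpa using h⟩

/-! ### Capacity -/

/-- The Sobolev functions that are `≥ 1` almost everywhere on an open neighbourhood of `E`. -/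
def capTest (m : Measure X) (E : Set X) : Set (W12 m) :=
  {F | ∃ U : Set X, IsOpen U ∧ E ⊆ U ∧ ∀ᵐ x ∂m, x ∈ U → 1 ≤ (F : X →ₘ[m] ℝ) x}

/-- The 2-capacity as a set function, `∞` if there is no competitor. -/
noncomputable def capFun (m : Measure X) (E : Set X) : ℝ≥0∞ :=
  ⨅ F ∈ capTest m E, sobolevNormSq m (F : X →ₘ[m] ℝ)

theorem capFun_mono {m : Measure X} {E E' : Set X} (h : E ⊆ E') : capFun m E ≤ capFun m E' :=
  biInf_mono fun _ ⟨U, hU, hE, hF⟩ => ⟨U, hU, h.trans hE, hF⟩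

theorem capFun_empty (m : Measure X) : capFun m ∅ = 0 := by
  refine le_antisymm ((iInf₂_le (0 : W12 m) ⟨∅, isOpen_empty, le_rfl, by simp⟩).trans ?_) zero_le
  have h0 : (fun _ : X => (0 : ℝ)) =ᵐ[m] (0 : X →ₘ[m] ℝ) := AEEqFun.coeFn_zero.symm
  refine (sobolevNormSq_le h0 isUpperGradient_zero).trans ?_
  simp

theorem capFun_iUnion_le (m : Measure X) (E : ℕ → Set X) :
    capFun m (⋃ n, E n) ≤ ∑' n, capFun m (E n) := by
  refine ENNReal.le_of_forall_pos_le_add fun ε hε hfin => ?_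
  obtain ⟨ε', hε', hsum⟩ := ENNReal.exists_pos_sum_of_countable (ENNReal.coe_pos.2 hε).ne' ℕ
  have hc : ∀ n, ∃ (f : X → ℝ) (g : X → ℝ≥0∞) (U : Set X), AEMeasurable f m ∧ IsUpperGradient f g ∧
      IsOpen U ∧ E n ⊆ U ∧ (∀ᵐ x ∂m, x ∈ U → 1 ≤ f x) ∧
      (∫⁻ x, ‖f x‖ₑ ^ 2 ∂m) + ∫⁻ x, g x ^ 2 ∂m ≤ capFun m (E n) + ε' n := by
    intro n
    have h1 : capFun m (E n) < capFun m (E n) + ε' n :=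
      ENNReal.lt_add_right (ENNReal.ne_top_of_tsum_ne_top hfin.ne n)
        (ENNReal.coe_pos.2 (hε' n)).ne'
    conv_lhs at h1 => rw [capFun]
    simp only [iInf_lt_iff] at h1
    obtain ⟨F, ⟨U, hU, hEU, hF⟩, hlt⟩ := h1
    obtain ⟨f, g, hf, hg, h⟩ := exists_of_sobolevNormSq_lt hlt
    refine ⟨f, g, U, (F : X →ₘ[m] ℝ).aemeasurable.congr hf.symm, hg, hU, hEU, ?_, h.le⟩
    filter_upwards [hf, hF] with x hx hx' hxU
    rw [hx]; exact hx' hxU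
  choose f g U hfm hg hU hEU hf1 hle using hc
  have hb : ∀ x, BddAbove (range fun n => max 0 (min 1 (f n x))) := fun x =>
    ⟨1, by rintro _ ⟨n, rfl⟩; exact max_le zero_le_one (min_le_left _ _)⟩
  set Φ : X → ℝ := fun x => ⨆ n, max 0 (min 1 (f n x)) with hΦ
  have hΦ0 : ∀ x, 0 ≤ Φ x := fun x => (le_max_left _ _).trans (le_ciSup (hb x) 0)
  have hG : IsUpperGradient Φ (fun x => ⨆ n, g n x) := by
    refine ⟨Measurable.iSup fun n => (hg n).1, fun L γ hL hγ => ?_⟩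
    by_cases htop : ∫⁻ t in Icc 0 L, ⨆ n, g n (γ t) = ∞
    · rw [htop]; exact le_top
    · rw [← ENNReal.ofReal_toReal htop]
      apply ENNReal.ofReal_le_ofReal
      set C := (∫⁻ t in Icc 0 L, ⨆ n, g n (γ t)).toReal
      have hn : ∀ n, |f n (γ 0) - f n (γ L)| ≤ C := by
        intro n
        have := (hg n).2 L γ hL hγ
        rw [← ENNReal.ofReal_le_ofReal_iff ENNReal.toReal_nonneg, ENNReal.ofReal_toReal htop]
        exact this.trans (lintegral_mono fun t => le_iSup (fun n => g n (γ t)) n)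
      have hcl : ∀ a b : ℝ, |a - b| ≤ C → max 0 (min 1 a) ≤ max 0 (min 1 b) + C := by
        intro a b hab
        have hC : 0 ≤ C := (abs_nonneg _).trans hab
        have := abs_le.1 hab
        rcases le_total 1 a with h1 | h1 <;> rcases le_total 1 b with h2 | h2 <;>
          rcases le_total 0 a with h3 | h3 <;> rcases le_total 0 b with h4 | h4 <;>
          simp [*] <;> linarith
      rw [abs_sub_le_iff]
      constructor
      · rw [sub_le_iff_le_add']
        refine ciSup_le fun n => (hcl _ _ (hn n)).trans ?_
        gcongr
        exact le_ciSup (hb (γ L)) n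
      · rw [sub_le_iff_le_add']
        refine ciSup_le fun n => (hcl _ _ (by rw [abs_sub_comm]; exact hn n)).trans ?_
        gcongr
        exact le_ciSup (hb (γ 0)) n
  have hΦm : AEMeasurable Φ m := by
    refine AEMeasurable.iSup fun n => ?_
    exact aemeasurable_const.max (aemeasurable_const.min (hfm n))
  have hbound : (∫⁻ x, ‖Φ x‖ₑ ^ 2 ∂m) + ∫⁻ x, (⨆ n, g n x) ^ 2 ∂m
      ≤ ∑' n, (capFun m (E n) + ε' n) := by
    have hA : ∫⁻ x, ‖Φ x‖ₑ ^ 2 ∂m ≤ ∑' n, ∫⁻ x, ‖f n x‖ₑ ^ 2 ∂m := by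
      rw [← lintegral_tsum fun n => (hfm n).enorm.pow_const 2]
      refine lintegral_mono fun x => ?_
      refine le_trans ?_ (ENNReal.tsum_le_tsum fun n => le_refl _)
      have : ‖Φ x‖ₑ ≤ ⨆ n, ‖f n x‖ₑ := by
        rw [Real.enorm_eq_ofReal (hΦ0 x)]
        by_cases htop : ⨆ n, ‖f n x‖ₑ = ∞
        · rw [htop]; exact le_top
        rw [ENNReal.ofReal_le_iff_le_toReal htop]
        refine ciSup_le fun n => ?_
        have h1 : max 0 (min 1 (f n x)) ≤ |f n x| :=
          max_le (abs_nonneg _) ((min_le_right _ _).trans (le_abs_self _))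
        refine h1.trans ?_
        rw [← ENNReal.ofReal_le_iff_le_toReal htop, ← Real.norm_eq_abs, ofReal_norm]
        exact le_iSup (fun n => ‖f n x‖ₑ) n
      refine (pow_le_pow_left' this 2).trans ?_
      rw [ENNReal.iSup_pow]
      exact iSup_le fun n => ENNReal.le_tsum n
    have hB : ∫⁻ x, (⨆ n, g n x) ^ 2 ∂m ≤ ∑' n, ∫⁻ x, g n x ^ 2 ∂m := by
      rw [← lintegral_tsum fun n => ((hg n).1.pow_const 2).aemeasurable]
      refine lintegral_mono fun x => ?_
      simp only
      rw [ENNReal.iSup_pow]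
      exact iSup_le fun n => ENNReal.le_tsum (f := fun n => g n x ^ 2) n
    refine (add_le_add hA hB).trans ?_
    rw [← ENNReal.tsum_add]
    exact ENNReal.tsum_le_tsum hle
  have htot : ∑' n, (capFun m (E n) + ε' n) ≤ (∑' n, capFun m (E n)) + ε := by
    rw [ENNReal.tsum_add]
    gcongr
  let F : X →ₘ[m] ℝ := AEEqFun.mk Φ hΦm.aestronglyMeasurable
  have hF : Φ =ᵐ[m] F := (AEEqFun.coeFn_mk _ _).symm
  have hFle := (sobolevNormSq_le hF hG).trans (hbound.trans htot)
  have hFmem : sobolevNormSq m F < ∞ :=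
    hFle.trans_lt (ENNReal.add_lt_top.2 ⟨hfin, ENNReal.coe_lt_top⟩)
  refine (iInf₂_le (⟨F, hFmem⟩ : W12 m) ⟨⋃ n, U n, isOpen_iUnion hU, iUnion_mono hEU, ?_⟩).trans hFle
  filter_upwards [hF, ae_all_iff.2 hf1] with x hx hx1 hxU
  obtain ⟨n, hn⟩ := mem_iUnion.1 hxU
  rw [← hx]
  refine le_trans ?_ (le_ciSup (hb x) n)
  exact le_max_of_le_right (le_min le_rfl (hx1 n hn))

/-- The 2-capacity, an outer measure on `X`. -/
noncomputable def cap (m : Measure X) : OuterMeasure X where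
  measureOf := capFun m
  empty := capFun_empty m
  mono := capFun_mono
  iUnion_nat := fun E _ => capFun_iUnion_le m E

variable [BorelSpace X]

theorem measure_le_cap (m : Measure X) (E : Set X) : m E ≤ cap m E := by
  change m E ≤ capFun m E
  refine le_iInf₂ fun F ⟨U, hU, hEU, hF⟩ => ?_
  calc m E ≤ m U := measure_mono hEU
    _ = ∫⁻ _ in U, 1 ∂m := by simp
    _ ≤ ∫⁻ x in U, ‖(F : X →ₘ[m] ℝ) x‖ₑ ^ 2 ∂m := by
        refine lintegral_mono_ae ?_
        refine (ae_restrict_iff' hU.measurableSet).2 ?_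
        filter_upwards [hF] with x hx hxU
        have h1 := hx hxU
        have : (1 : ℝ≥0∞) ≤ ‖(F : X →ₘ[m] ℝ) x‖ₑ := by
          rw [Real.enorm_eq_ofReal (zero_le_one.trans h1)]
          exact ENNReal.one_le_ofReal.2 h1
        exact one_le_pow₀ this
    _ ≤ ∫⁻ x, ‖(F : X →ₘ[m] ℝ) x‖ₑ ^ 2 ∂m := setLIntegral_le_lintegral _ _
    _ ≤ sobolevNormSq m (F : X →ₘ[m] ℝ) := le_self_add

theorem ae_of_ae_cap {m : Measure X} {p : X → Prop} (h : ∀ᵐ x ∂(cap m), p x) : ∀ᵐ x ∂m, p x := by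
  rw [ae_iff] at h ⊢
  exact le_antisymm ((measure_le_cap m _).trans h.le) zero_le

/-! ### Functions up to capacity-null sets -/

variable (X) in
/-- The Borel real-valued functions on `X`. -/
def borelFun : Submodule ℝ (X → ℝ) where
  carrier := {f | Measurable f}
  zero_mem' := measurable_const
  add_mem' := fun hf hg => hf.add hg
  smul_mem' := fun c _ hf => hf.const_smul c

/-- The Borel functions that vanish `Cap`-a.e. -/
def capNull (m : Measure X) : Submodule ℝ (borelFun X) where
  carrier := {f | ∀ᵐ x ∂(cap m), (f : X → ℝ) x = 0}
  zero_mem' := by simp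
  add_mem' := by
    intro f g hf hg
    change ∀ᵐ x ∂(cap m), (f : X → ℝ) x + (g : X → ℝ) x = 0
    filter_upwards [show ∀ᵐ x ∂(cap m), (f : X → ℝ) x = 0 from hf,
      show ∀ᵐ x ∂(cap m), (g : X → ℝ) x = 0 from hg] with x hx hy
    rw [hx, hy, add_zero]
  smul_mem' := by
    intro c f hf
    change ∀ᵐ x ∂(cap m), c * (f : X → ℝ) x = 0
    filter_upwards [show ∀ᵐ x ∂(cap m), (f : X → ℝ) x = 0 from hf] with x hx
    rw [hx, mul_zero]

/-- `L⁰(Cap)`: Borel functions up to `Cap`-a.e. equality. -/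
abbrev L0Cap (m : Measure X) : Type _ := borelFun X ⧸ capNull m

/-- The class `[f]_Cap` of a Borel function. -/
def L0Cap.mk (m : Measure X) (f : X → ℝ) (hf : Measurable f) : L0Cap m :=
  Submodule.Quotient.mk (⟨f, hf⟩ : borelFun X)

theorem L0Cap.mk_eq_mk_iff {m : Measure X} {f g : X → ℝ} (hf : Measurable f) (hg : Measurable g) :
    L0Cap.mk m f hf = L0Cap.mk m g hg ↔ cap m {x | f x ≠ g x} = 0 := by
  rw [L0Cap.mk, L0Cap.mk, Submodule.Quotient.eq]
  change (∀ᵐ x ∂(cap m), f x - g x = 0) ↔ _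
  simp only [sub_eq_zero, ae_iff, ne_eq]

/-- A Borel representative of an element of `L⁰(Cap)`. -/
noncomputable def L0Cap.rep {m : Measure X} (F : L0Cap m) : X → ℝ :=
  ((Quotient.out F : borelFun X) : X → ℝ)

theorem L0Cap.measurable_rep {m : Measure X} (F : L0Cap m) : Measurable F.rep :=
  (Quotient.out F : borelFun X).2

theorem L0Cap.mk_rep {m : Measure X} (F : L0Cap m) : L0Cap.mk m F.rep F.measurable_rep = F :=
  Quotient.out_eq F

/-- The projection `[f]_Cap ↦ [f]_m` from `L⁰(Cap)` to `L⁰(m)`. -/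
noncomputable def proj (m : Measure X) : L0Cap m →ₗ[ℝ] (X →ₘ[m] ℝ) :=
  (capNull m).liftQ
    { toFun := fun f => AEEqFun.mk (f : X → ℝ) (Measurable.aestronglyMeasurable f.2)
      map_add' := fun _ _ => rfl
      map_smul' := fun _ _ => rfl }
    (by
      intro f hf
      rw [LinearMap.mem_ker]
      exact (AEEqFun.mk_eq_mk (hf := Measurable.aestronglyMeasurable f.2)
        (hg := aestronglyMeasurable_const)).2 (ae_of_ae_cap hf))

/-! ### Quasi-continuity -/

/-- Quasi-continuity: continuity off sets of arbitrarily small capacity. -/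
def IsQuasiContinuous (m : Measure X) (f : X → ℝ) : Prop :=
  ∀ ε : ℝ≥0∞, 0 < ε → ∃ E : Set X, cap m E < ε ∧ ContinuousOn f Eᶜ

/-- `QC(X)`: the classes of quasi-continuous functions, a linear subspace of `L⁰(Cap)`. -/
def QC (m : Measure X) : Submodule ℝ (L0Cap m) where
  carrier := {F | ∃ (f : X → ℝ) (hf : Measurable f), IsQuasiContinuous m f ∧ L0Cap.mk m f hf = F}
  zero_mem' := ⟨0, measurable_const,
    fun ε hε => ⟨∅, by simpa using hε, continuousOn_const⟩, rfl⟩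
  add_mem' := by
    rintro _ _ ⟨f, hf, hfq, rfl⟩ ⟨g, hg, hgq, rfl⟩
    refine ⟨f + g, hf.add hg, fun ε hε => ?_, rfl⟩
    obtain ⟨E, hE, hfE⟩ := hfq (ε / 2) (ENNReal.half_pos hε.ne')
    obtain ⟨E', hE', hgE⟩ := hgq (ε / 2) (ENNReal.half_pos hε.ne')
    refine ⟨E ∪ E', (measure_union_le E E').trans_lt ?_, ?_⟩
    · calc cap m E + cap m E' < ε / 2 + ε / 2 := ENNReal.add_lt_add hE hE'
        _ = ε := ENNReal.add_halves ε
    · exact (hfE.mono (compl_subset_compl.2 subset_union_left)).add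
        (hgE.mono (compl_subset_compl.2 subset_union_right))
  smul_mem' := by
    rintro c _ ⟨f, hf, hfq, rfl⟩
    refine ⟨c • f, hf.const_smul c, fun ε hε => ?_, rfl⟩
    obtain ⟨E, hE, hfE⟩ := hfq ε hε
    exact ⟨E, hE, hfE.const_smul c⟩

/-- An increasing sequence of open sets of finite capacity that absorbs the bounded sets. -/
structure IsExhaustion (m : Measure X) (A : ℕ → Set X) : Prop where
  mono : Monotone A
  isOpen : ∀ k, IsOpen (A k)
  cap_lt_top : ∀ k, cap m (A k) < ∞
  absorbs : ∀ B : Set X, Bornology.IsBounded B → ∃ k, B ⊆ A k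

/-- The distance `d_QU` built on the sequence `A`. -/
noncomputable def distQU (m : Measure X) (A : ℕ → Set X) (f g : X → ℝ) : ℝ≥0∞ :=
  ⨅ E : Set X, ∑' k : ℕ, (cap m (E ∩ A k) / (2 ^ k * max (cap m (A k)) 1) +
    (2 ^ k)⁻¹ * ⨆ x ∈ A k \ E, ENNReal.ofReal (min |f x - g x| 1))

/-- Continuity of a map from `W^{1,2}` with its norm to `QC(X)` with the distance `d_QU`. -/
def ContinuousToQC {m : Measure X} (A : ℕ → Set X) (T : W12 m → QC m) : Prop :=
  ∀ F : W12 m, ∀ ε : ℝ≥0∞, 0 < ε → ∃ δ : ℝ, 0 < δ ∧ ∀ G : W12 m, sobolevNorm (G - F) < δ →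
    distQU m A (T G : L0Cap m).rep (T F : L0Cap m).rep < ε

/-- Local quasi-uniform convergence. -/
def TendstoQU (m : Measure X) (f : ℕ → X → ℝ) (f' : X → ℝ) : Prop :=
  ∀ B : Set X, Bornology.IsBounded B → ∀ ε : ℝ≥0∞, 0 < ε →
    ∃ E : Set X, cap m E < ε ∧ TendstoUniformlyOn f f' atTop (B \ E)

/-- The classes of continuous functions that lie in `W^{1,2}` are dense in `W^{1,2}`. -/
def ContinuousDense (m : Measure X) : Prop :=
  ∀ F : W12 m, ∀ ε : ℝ, 0 < ε → ∃ (G : W12 m) (g : X → ℝ), Continuous g ∧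
    ((G : X →ₘ[m] ℝ) : X → ℝ) =ᵐ[m] g ∧ sobolevNorm (F - G) < ε

end QCSobolev

/-!
Everything rests on one capacitary Chebyshev inequality, `cap_lt_abs_le`: if `f` is quasi-continuous
and represents the Sobolev function `F`, then `Cap {c < |f|} ≤ 4 c⁻² ‖F‖²`. To see it, take an
open set `U` of capacity `< ε` such that `f` restricted to `X \ U` is continuous. Then
`{c < |f|} ∪ U` is open, and `|H| + c⁻¹ |F|` is a competitor for its capacity whenever `H` is one for `U`.

Applied to `F = 0`, the inequality shows that two quasi-continuous functions that agree `m`-a.e.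
agree `Cap`-a.e. (`IsQuasiContinuous.ae_cap_eq`). Hence `Pr` is injective on `QC(X)`
(`proj_injOn_QC`), so a right inverse `QCR` is unique even without continuity, and linearity
and compatibility with absolute values are inherited from `L⁰(m)`.

A quasi-continuous representative of `F` is the limit of continuous Sobolev functions `gₙ → F`
chosen so that `∑ Cap {2⁻ⁿ < |gₙ - gₙ₊₁|} < ∞` (`exists_quasiContinuous_rep`). Continuity of `QCR`
and the convergence of subsequences are the same inequality applied to the differences of
representatives. Both hold globally on `X`, and the exhaustion only enters through the bound
`distQU_le`.
-/

namespace QCSobolev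

variable {X : Type*} [MetricSpace X] [MeasurableSpace X] {m : Measure X}

/-! ### The Sobolev norm -/

theorem sobolevNormSq_lt_top (F : W12 m) : sobolevNormSq m (F : X →ₘ[m] ℝ) < ∞ := F.2

theorem sobolevNormSq_eq_ofReal (F : W12 m) :
    sobolevNormSq m (F : X →ₘ[m] ℝ) = ENNReal.ofReal (sobolevNorm F ^ 2) := by
  rw [sobolevNorm, Real.sq_sqrt ENNReal.toReal_nonneg,
    ENNReal.ofReal_toReal (sobolevNormSq_lt_top F).ne]

theorem sobolevNorm_nonneg (F : W12 m) : 0 ≤ sobolevNorm F := Real.sqrt_nonneg _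

theorem ennreal_add_sq_le (a b : ℝ≥0∞) : (a + b) ^ 2 ≤ 4 * a ^ 2 + 4 * b ^ 2 := by
  rcases le_total a b with hab | hab
  · calc (a + b) ^ 2 ≤ (b + b) ^ 2 := by gcongr
      _ = 4 * b ^ 2 := by ring
      _ ≤ _ := le_add_self
  · calc (a + b) ^ 2 ≤ (a + a) ^ 2 := by gcongr
      _ = 4 * a ^ 2 := by ring
      _ ≤ _ := le_self_add

/-- A quasi-triangle inequality. It suffices for all limits here, so the sharp constant, and the
triangle inequality for `sobolevNorm`, are not needed. -/
theorem sobolevNormSq_add_le (F G : X →ₘ[m] ℝ) :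
    sobolevNormSq m (F + G) ≤ 4 * (sobolevNormSq m F + sobolevNormSq m G) := by
  refine ENNReal.le_of_forall_pos_le_add fun ε hε hfin => ?_
  have hFG : sobolevNormSq m F + sobolevNormSq m G < ∞ := by
    by_contra h
    rw [not_lt, top_le_iff] at h
    simp [h] at hfin
  obtain ⟨hF, hG⟩ := ENNReal.add_lt_top.1 hFG
  have hε8 : ((ε : ℝ≥0∞) / 8) ≠ 0 := by simp [hε.ne']
  obtain ⟨f, g, hf, hg, h⟩ := exists_of_sobolevNormSq_lt (ENNReal.lt_add_right hF.ne hε8)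
  obtain ⟨f', g', hf', hg', h'⟩ := exists_of_sobolevNormSq_lt (ENNReal.lt_add_right hG.ne hε8)
  have hs : f + f' =ᵐ[m] ((F + G : X →ₘ[m] ℝ) : X → ℝ) :=
    (hf.add hf').trans (AEEqFun.coeFn_add F G).symm
  have hfm : AEMeasurable f m := F.aemeasurable.congr hf.symm
  have h1 : ∫⁻ x, ‖(f + f') x‖ₑ ^ 2 ∂m ≤
      4 * (∫⁻ x, ‖f x‖ₑ ^ 2 ∂m) + 4 * ∫⁻ x, ‖f' x‖ₑ ^ 2 ∂m :=
    calc ∫⁻ x, ‖(f + f') x‖ₑ ^ 2 ∂m ≤ ∫⁻ x, (4 * ‖f x‖ₑ ^ 2 + 4 * ‖f' x‖ₑ ^ 2) ∂m :=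
          lintegral_mono fun x =>
            (pow_le_pow_left' (enorm_add_le _ _) 2).trans (ennreal_add_sq_le _ _)
      _ = _ := by
          rw [lintegral_add_left' ((hfm.enorm.pow_const 2).const_mul 4),
            lintegral_const_mul' _ _ (by simp), lintegral_const_mul' _ _ (by simp)]
  have h2 : ∫⁻ x, (g + g') x ^ 2 ∂m ≤ 4 * (∫⁻ x, g x ^ 2 ∂m) + 4 * ∫⁻ x, g' x ^ 2 ∂m :=
    calc ∫⁻ x, (g + g') x ^ 2 ∂m ≤ ∫⁻ x, (4 * g x ^ 2 + 4 * g' x ^ 2) ∂m :=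
          lintegral_mono fun x => ennreal_add_sq_le _ _
      _ = _ := by
          rw [lintegral_add_left ((hg.1.pow_const 2).const_mul 4),
            lintegral_const_mul' _ _ (by simp), lintegral_const_mul' _ _ (by simp)]
  refine ((sobolevNormSq_le hs (hg.add hg')).trans (add_le_add h1 h2)).trans ?_
  calc 4 * (∫⁻ x, ‖f x‖ₑ ^ 2 ∂m) + 4 * (∫⁻ x, ‖f' x‖ₑ ^ 2 ∂m) +
        (4 * (∫⁻ x, g x ^ 2 ∂m) + 4 * ∫⁻ x, g' x ^ 2 ∂m)
      = 4 * (((∫⁻ x, ‖f x‖ₑ ^ 2 ∂m) + ∫⁻ x, g x ^ 2 ∂m) +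
          ((∫⁻ x, ‖f' x‖ₑ ^ 2 ∂m) + ∫⁻ x, g' x ^ 2 ∂m)) := by ring
    _ ≤ 4 * ((sobolevNormSq m F + ε / 8) + (sobolevNormSq m G + ε / 8)) := by gcongr
    _ = 4 * (sobolevNormSq m F + sobolevNormSq m G) + 8 * (ε / 8) := by ring
    _ = 4 * (sobolevNormSq m F + sobolevNormSq m G) + ε := by
        rw [ENNReal.mul_div_cancel (by simp) (by simp)]

theorem sobolevNormSq_smul_le (c : ℝ) (F : X →ₘ[m] ℝ) :
    sobolevNormSq m (c • F) ≤ ENNReal.ofReal (c ^ 2) * sobolevNormSq m F := by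
  rcases eq_or_ne c 0 with rfl | hc
  · have h0 : (fun _ : X => (0 : ℝ)) =ᵐ[m] (((0 : ℝ) • F : X →ₘ[m] ℝ) : X → ℝ) := by
      rw [zero_smul]
      exact AEEqFun.coeFn_zero.symm
    exact (sobolevNormSq_le h0 isUpperGradient_zero).trans (by simp)
  have hc2 : ENNReal.ofReal (c ^ 2) ≠ 0 := by simpa using hc
  rw [mul_comm, ← ENNReal.div_le_iff_le_mul (.inl hc2) (.inl ENNReal.ofReal_ne_top)]
  refine le_of_forall_gt fun a ha => ?_
  obtain ⟨f, g, hf, hg, h⟩ := exists_of_sobolevNormSq_lt ha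
  have hs : (fun x => c * f x) =ᵐ[m] ((c • F : X →ₘ[m] ℝ) : X → ℝ) := by
    filter_upwards [hf, AEEqFun.coeFn_smul c F] with x hx hx'
    rw [hx', Pi.smul_apply, hx, smul_eq_mul]
  refine lt_of_le_of_lt ?_ h
  rw [ENNReal.div_le_iff_le_mul (.inl hc2) (.inl ENNReal.ofReal_ne_top)]
  refine (sobolevNormSq_le hs (hg.const_mul c)).trans (le_of_eq ?_)
  have hc' : ENNReal.ofReal (c ^ 2) = ENNReal.ofReal |c| ^ 2 := by
    rw [← ENNReal.ofReal_pow (abs_nonneg c), sq_abs]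
  simp only [enorm_mul, mul_pow, Real.enorm_eq_ofReal_abs c]
  rw [lintegral_const_mul' _ _ (by simp), lintegral_const_mul' _ _ (by simp), hc']
  ring

theorem sobolevNormSq_sub_comm (F G : X →ₘ[m] ℝ) :
    sobolevNormSq m (F - G) ≤ sobolevNormSq m (G - F) := by
  have := sobolevNormSq_smul_le (-1) (G - F)
  simpa using this

theorem sobolevNormSq_abs_le (F : X →ₘ[m] ℝ) : sobolevNormSq m |F| ≤ sobolevNormSq m F := by
  refine le_of_forall_gt fun a ha => ?_
  obtain ⟨f, g, hf, hg, h⟩ := exists_of_sobolevNormSq_lt ha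
  have hs : (fun x => |f x|) =ᵐ[m] ((|F| : X →ₘ[m] ℝ) : X → ℝ) := by
    filter_upwards [hf, AEEqFun.coeFn_abs F] with x hx hx'
    rw [hx', hx]
  refine (sobolevNormSq_le hs (hg.of_le fun x y => abs_abs_sub_abs_le _ _)).trans_lt ?_
  simpa using h

/-! ### Quasi-continuous functions and the capacitary Chebyshev inequality -/

theorem cap_le_of_mem_capTest {E : Set X} {F : W12 m} (hF : F ∈ capTest m E) :
    cap m E ≤ sobolevNormSq m (F : X →ₘ[m] ℝ) :=
  iInf₂_le (f := fun (F : W12 m) (_ : F ∈ capTest m E) => sobolevNormSq m (F : X →ₘ[m] ℝ)) F hF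

/-- Capacity is outer regular, since competitors are large on a neighbourhood. -/
theorem exists_isOpen_of_cap_lt {E : Set X} {c : ℝ≥0∞} (h : cap m E < c) :
    ∃ (U : Set X) (H : W12 m), IsOpen U ∧ E ⊆ U ∧
      (∀ᵐ x ∂m, x ∈ U → 1 ≤ (H : X →ₘ[m] ℝ) x) ∧ sobolevNormSq m (H : X →ₘ[m] ℝ) < c := by
  change capFun m E < c at h
  simp only [capFun, iInf_lt_iff] at h
  obtain ⟨H, ⟨U, hU, hEU, hH⟩, hlt⟩ := h
  exact ⟨U, H, hU, hEU, hH, hlt⟩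

theorem isQuasiContinuous_of_continuous {f : X → ℝ} (hf : Continuous f) :
    IsQuasiContinuous m f :=
  fun ε hε => ⟨∅, by simpa using hε, hf.continuousOn⟩

theorem IsQuasiContinuous.comp_continuous {f : X → ℝ} (hf : IsQuasiContinuous m f) {φ : ℝ → ℝ}
    (hφ : Continuous φ) : IsQuasiContinuous m (fun x => φ (f x)) := fun ε hε =>
  let ⟨E, hE, hfE⟩ := hf ε hε
  ⟨E, hE, hφ.comp_continuousOn hfE⟩

theorem IsQuasiContinuous.sub {f g : X → ℝ} (hf : IsQuasiContinuous m f)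
    (hg : IsQuasiContinuous m g) : IsQuasiContinuous m (fun x => f x - g x) := by
  intro ε hε
  obtain ⟨E, hE, hfE⟩ := hf (ε / 2) (ENNReal.half_pos hε.ne')
  obtain ⟨E', hE', hgE⟩ := hg (ε / 2) (ENNReal.half_pos hε.ne')
  refine ⟨E ∪ E', (measure_union_le E E').trans_lt ?_, ?_⟩
  · exact (ENNReal.add_lt_add hE hE').trans_eq (ENNReal.add_halves ε)
  · exact (hfE.mono (compl_subset_compl.2 subset_union_left)).sub
      (hgE.mono (compl_subset_compl.2 subset_union_right))

theorem IsQuasiContinuous.congr {f g : X → ℝ} (hf : IsQuasiContinuous m f)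
    (h : ∀ᵐ x ∂(cap m), f x = g x) : IsQuasiContinuous m g := by
  intro ε hε
  obtain ⟨E, hE, hfE⟩ := hf ε hε
  refine ⟨E ∪ {x | ¬ f x = g x}, (measure_union_le _ _).trans_lt ?_, ?_⟩
  · rwa [ae_iff.1 h, add_zero]
  · refine (hfE.mono (compl_subset_compl.2 subset_union_left)).congr fun x hx => ?_
    by_contra hne
    exact hx (Or.inr fun h => hne h.symm)

/-- The capacitary Chebyshev inequality. -/
theorem cap_lt_abs_le {f : X → ℝ} (hf : IsQuasiContinuous m f) {F : W12 m}
    (hfF : f =ᵐ[m] (F : X →ₘ[m] ℝ)) {c : ℝ} (hc : 0 < c) :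
    cap m {x | c < |f x|} ≤
      4 * (ENNReal.ofReal (c⁻¹ ^ 2) * sobolevNormSq m (F : X →ₘ[m] ℝ)) := by
  refine ENNReal.le_of_forall_pos_le_add fun ε hε _ => ?_
  have hε4 : (0 : ℝ≥0∞) < ε / 4 := by simp [hε.ne']
  obtain ⟨E, hE, hfE⟩ := hf _ hε4
  obtain ⟨U, H, hU, hEU, hH, hHε⟩ := exists_isOpen_of_cap_lt hE
  have hfU : ContinuousOn f Uᶜ := hfE.mono (compl_subset_compl.2 hEU)
  obtain ⟨W, hW, hWU⟩ := continuousOn_iff'.1 hfU {y | c < |y|}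
    (isOpen_lt continuous_const continuous_abs)
  have hmem : ∀ x ∉ U, (x ∈ W ↔ c < |f x|) := fun x hx => by
    have := congrArg (x ∈ ·) hWU
    simpa [hx] using this.symm
  let K : W12 m := sobolevAbs H + c⁻¹ • sobolevAbs F
  have hK : (K : X →ₘ[m] ℝ) =
      |(H : X →ₘ[m] ℝ)| + c⁻¹ • |(F : X →ₘ[m] ℝ)| := rfl
  have hKtest : K ∈ capTest m {x | c < |f x|} := by
    refine ⟨W ∪ U, hW.union hU, fun x hx => ?_, ?_⟩
    · by_cases hxU : x ∈ U
      · exact Or.inr hxU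
      · exact Or.inl ((hmem x hxU).2 hx)
    · rw [hK]
      filter_upwards [hH, hfF, AEEqFun.coeFn_abs (H : X →ₘ[m] ℝ),
        AEEqFun.coeFn_abs (F : X →ₘ[m] ℝ),
        AEEqFun.coeFn_add |(H : X →ₘ[m] ℝ)| (c⁻¹ • |(F : X →ₘ[m] ℝ)|),
        AEEqFun.coeFn_smul c⁻¹ |(F : X →ₘ[m] ℝ)|] with x h1 h2 h3 h4 h5 h6 hx
      rw [h5, Pi.add_apply, h3, h6, Pi.smul_apply, h4, smul_eq_mul, ← h2]
      by_cases hxU : x ∈ U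
      · have : 0 ≤ c⁻¹ * |f x| := by positivity
        linarith [h1 hxU, le_abs_self ((H : X →ₘ[m] ℝ) x)]
      · have hlt : c < |f x| := (hmem x hxU).1 (hx.resolve_right hxU)
        have : 1 ≤ c⁻¹ * |f x| := by
          rw [← inv_mul_cancel₀ hc.ne']
          gcongr
        linarith [abs_nonneg ((H : X →ₘ[m] ℝ) x)]
  calc cap m {x | c < |f x|} ≤ sobolevNormSq m (K : X →ₘ[m] ℝ) := cap_le_of_mem_capTest hKtest
    _ ≤ 4 * (sobolevNormSq m |(H : X →ₘ[m] ℝ)| + sobolevNormSq m (c⁻¹ • |(F : X →ₘ[m] ℝ)|)) :=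
        hK ▸ sobolevNormSq_add_le _ _
    _ ≤ 4 * (ε / 4 + ENNReal.ofReal (c⁻¹ ^ 2) * sobolevNormSq m (F : X →ₘ[m] ℝ)) := by
        gcongr
        · exact (sobolevNormSq_abs_le _).trans hHε.le
        · refine (sobolevNormSq_smul_le _ _).trans ?_
          gcongr
          exact sobolevNormSq_abs_le _
    _ = _ := by
        rw [mul_add, ENNReal.mul_div_cancel (by simp) (by simp), add_comm]

theorem sobolevNormSq_zero : sobolevNormSq m (0 : X →ₘ[m] ℝ) = 0 := by
  simpa using sobolevNormSq_smul_le 0 (0 : X →ₘ[m] ℝ)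

/-- Quasi-continuous functions are determined up to capacity-null sets by their values up to
`m`-null sets. -/
theorem IsQuasiContinuous.ae_cap_eq {f g : X → ℝ} (hf : IsQuasiContinuous m f)
    (hg : IsQuasiContinuous m g) (h : f =ᵐ[m] g) : ∀ᵐ x ∂(cap m), f x = g x := by
  have h0 : (fun x => f x - g x) =ᵐ[m] ((0 : W12 m) : X →ₘ[m] ℝ) := by
    filter_upwards [h, AEEqFun.coeFn_zero (α := X) (μ := m) (β := ℝ)] with x hx hx'
    rw [hx, sub_self, Submodule.coe_zero, hx', Pi.zero_apply]
  have hn : ∀ n : ℕ, ∀ᵐ x ∂(cap m), |f x - g x| ≤ 1 / (n + 1) := fun n => by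
    rw [ae_iff]
    simp only [not_le]
    refine le_antisymm ((cap_lt_abs_le (hf.sub hg) h0 (by positivity)).trans ?_) zero_le
    rw [Submodule.coe_zero, sobolevNormSq_zero, mul_zero, mul_zero]
  filter_upwards [ae_all_iff.2 hn] with x hx
  have : |f x - g x| ≤ 0 := ge_of_tendsto' tendsto_one_div_add_atTop_nhds_zero_nat hx
  exact sub_eq_zero.1 (abs_nonpos_iff.1 this)

/-! ### Borel–Cantelli and quasi-uniform limits -/

/-- Borel–Cantelli: the tails of a sequence of sets of summable capacity have small union. -/
theorem exists_cap_iUnion_lt {E : ℕ → Set X} (h : ∑' n, cap m (E n) ≠ ∞) {ε : ℝ≥0∞}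
    (hε : 0 < ε) : ∃ N, cap m (⋃ n, E (n + N)) < ε := by
  obtain ⟨N, hN⟩ := ((ENNReal.tendsto_sum_nat_add _ h).eventually_lt_const hε).exists
  exact ⟨N, (measure_iUnion_le _).trans_lt hN⟩

/-- If the Sobolev norms decay like `4⁻ⁿ`, the sets `{2⁻ⁿ < |fₙ|}` have summable capacities. -/
theorem tsum_cap_lt_abs_ne_top {f : ℕ → X → ℝ} (hf : ∀ n, IsQuasiContinuous m (f n))
    {F : ℕ → W12 m} (hfF : ∀ n, f n =ᵐ[m] (F n : X →ₘ[m] ℝ)) {C : ℝ}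
    (hF : ∀ n, sobolevNormSq m (F n : X →ₘ[m] ℝ) ≤ ENNReal.ofReal (C * (1 / 16) ^ n)) :
    ∑' n, cap m {x | (1 / 2) ^ n < |f n x|} ≠ ∞ := by
  have hle : ∀ n, cap m {x | (1 / 2) ^ n < |f n x|} ≤
      4 * ENNReal.ofReal (C * (1 / 4) ^ n) := fun n => by
    refine (cap_lt_abs_le (hf n) (hfF n) (by positivity)).trans ?_
    gcongr
    refine (mul_le_mul_right (hF n) _).trans (le_of_eq ?_)
    rw [← ENNReal.ofReal_mul (by positivity)]
    congr 1
    have : (((1 / 2 : ℝ) ^ n)⁻¹) ^ 2 = 4 ^ n := by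
      rw [← inv_pow, ← pow_mul, mul_comm, pow_mul]
      norm_num
    rw [this, mul_left_comm, ← mul_pow]
    norm_num
  refine ne_top_of_le_ne_top ?_ (ENNReal.tsum_le_tsum hle)
  rw [ENNReal.tsum_mul_left]
  refine ENNReal.mul_ne_top (by simp) ?_
  exact ((summable_geometric_of_lt_one (by norm_num) (by norm_num)).mul_left C).tsum_ofReal_ne_top

/-- Testing `distQU` with `E = {c < |f - g|}` gives a bound that does not depend on `A`. -/
theorem distQU_le (A : ℕ → Set X) (f g : X → ℝ) (c : ℝ) :
    distQU m A f g ≤ 2 * (cap m {x | c < |f x - g x|} + ENNReal.ofReal c) := by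
  refine (iInf_le _ {x | c < |f x - g x|}).trans ?_
  have h2 : ∑' k : ℕ, ((2 : ℝ≥0∞) ^ k)⁻¹ = 2 := by
    simpa only [ENNReal.inv_pow] using ENNReal.tsum_geometric_two
  conv_rhs => rw [← h2, ← ENNReal.tsum_mul_right]
  refine ENNReal.tsum_le_tsum fun k => ?_
  rw [mul_add]
  gcongr
  · rw [ENNReal.div_eq_inv_mul, ENNReal.mul_inv (by simp) (by simp)]
    gcongr ?_ * ?_
    · exact mul_le_of_le_one_right zero_le (ENNReal.inv_le_one.2 (le_max_right _ _))
    · exact measure_mono inter_subset_left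
  · refine iSup₂_le fun x hx => ENNReal.ofReal_le_ofReal ?_
    exact (min_le_left _ _).trans (not_lt.1 hx.2)

variable [BorelSpace X]

/-- Every Sobolev function has a Borel quasi-continuous representative. -/
theorem exists_quasiContinuous_rep (hdense : ContinuousDense m) (F : W12 m) :
    ∃ f : X → ℝ, Measurable f ∧ IsQuasiContinuous m f ∧ f =ᵐ[m] (F : X →ₘ[m] ℝ) := by
  choose G g hg hGg hFG using fun n : ℕ => hdense F ((1 / 4) ^ n) (by positivity)
  have hFGsq : ∀ n, sobolevNormSq m ((F : X →ₘ[m] ℝ) - G n) ≤ ENNReal.ofReal ((1 / 16) ^ n) := by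
    intro n
    rw [← Submodule.coe_sub, sobolevNormSq_eq_ofReal]
    apply ENNReal.ofReal_le_ofReal
    calc sobolevNorm (F - G n) ^ 2 ≤ ((1 / 4) ^ n) ^ 2 := by
          gcongr
          · exact sobolevNorm_nonneg _
          · exact (hFG n).le
      _ = (1 / 16) ^ n := by rw [← pow_mul, mul_comm, pow_mul]; norm_num
  have hGG : ∀ n, sobolevNormSq m ((G n - G (n + 1) : W12 m) : X →ₘ[m] ℝ) ≤
      ENNReal.ofReal (8 * (1 / 16) ^ n) := fun n => by
    have h1 := (sobolevNormSq_sub_comm (G n : X →ₘ[m] ℝ) F).trans (hFGsq n)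
    have h2 := (hFGsq (n + 1)).trans (ENNReal.ofReal_le_ofReal
      (pow_le_pow_of_le_one (by norm_num) (by norm_num) n.le_succ : (1 / 16 : ℝ) ^ (n + 1) ≤ _))
    have h3 := sobolevNormSq_add_le ((G n : X →ₘ[m] ℝ) - (F : X →ₘ[m] ℝ))
      ((F : X →ₘ[m] ℝ) - (G (n + 1) : X →ₘ[m] ℝ))
    rw [sub_add_sub_cancel] at h3
    calc _ ≤ _ := h3
      _ ≤ 4 * (ENNReal.ofReal ((1 / 16) ^ n) + ENNReal.ofReal ((1 / 16) ^ n)) := by gcongr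
      _ = _ := by
        rw [← two_mul, ← mul_assoc, ENNReal.ofReal_mul (by norm_num)]
        norm_num
  have hgqc : ∀ n, IsQuasiContinuous m (fun x => g n x - g (n + 1) x) := fun n =>
    isQuasiContinuous_of_continuous ((hg n).sub (hg (n + 1)))
  have hgG : ∀ n, (fun x => g n x - g (n + 1) x) =ᵐ[m]
      ((G n - G (n + 1) : W12 m) : X →ₘ[m] ℝ) := fun n => by
    rw [Submodule.coe_sub]
    filter_upwards [hGg n, hGg (n + 1),
      AEEqFun.coeFn_sub (G n : X →ₘ[m] ℝ) (G (n + 1))] with x h1 h2 h3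
    rw [h3, Pi.sub_apply, h1, h2]
  have hsum := tsum_cap_lt_abs_ne_top hgqc hgG hGG
  set E : ℕ → Set X := fun n => {x | (1 / 2) ^ n < |g n x - g (n + 1) x|}
  -- Being a limsup, `f` is Borel everywhere; it is the limit off a set of zero capacity.
  let f : X → ℝ := fun x => limsup (fun n => g n x) atTop
  have hfm : Measurable f := Measurable.limsup fun n => (hg n).measurable
  have hdist : ∀ N, ∀ x ∉ ⋃ n, E (n + N), ∀ n,
      dist (g (n + N) x) (g (n + 1 + N) x) ≤ 2 * (1 / 2) ^ N / 2 / 2 ^ n := by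
    intro N x hx n
    have hxn : x ∉ E (n + N) := fun h => hx (mem_iUnion.2 ⟨n, h⟩)
    rw [Real.dist_eq, add_right_comm n 1 N]
    refine (not_lt.1 hxn).trans (le_of_eq ?_)
    rw [pow_add, one_div, inv_pow, inv_pow]
    field_simp
  have hlim : ∀ N, ∀ x ∉ ⋃ n, E (n + N), Tendsto (fun n => g n x) atTop (𝓝 (f x)) := by
    intro N x hx
    obtain ⟨a, ha⟩ := cauchySeq_tendsto_of_complete
      (cauchySeq_of_le_geometric_two (hdist N x hx))
    have ha' : Tendsto (fun n => g n x) atTop (𝓝 a) := (tendsto_add_atTop_iff_nat N).1 ha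
    rwa [show f x = a from ha'.limsup_eq]
  have hunif : ∀ N, TendstoUniformlyOn (fun n => g (n + N)) f atTop (⋃ n, E (n + N))ᶜ := by
    intro N
    rw [Metric.tendstoUniformlyOn_iff]
    intro δ hδ
    have h0 : Tendsto (fun n : ℕ => 2 * (1 / 2 : ℝ) ^ N / 2 ^ n) atTop (𝓝 0) :=
      tendsto_const_nhds.div_atTop (tendsto_pow_atTop_atTop_of_one_lt one_lt_two)
    filter_upwards [h0.eventually_lt_const hδ] with n hn x hx
    rw [dist_comm]
    exact (dist_le_of_le_geometric_two_of_tendsto (hdist N x hx)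
      ((tendsto_add_atTop_iff_nat N).2 (hlim N x hx)) n).trans_lt hn
  refine ⟨f, hfm, fun ε hε => ?_, ?_⟩
  · obtain ⟨N, hN⟩ := exists_cap_iUnion_lt hsum hε
    exact ⟨_, hN, (hunif N).continuousOn
      (Frequently.of_forall fun n => (hg (n + N)).continuousOn)⟩
  · -- `gₙ → f` `m`-a.e., while `gₙ → F` `m`-a.e. because `∑ |F - gₙ|²` is integrable.
    have hf_lim : ∀ᵐ x ∂m, Tendsto (fun n => g n x) atTop (𝓝 (f x)) := by
      refine ae_of_ae_cap ?_
      rw [ae_iff]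
      refine le_antisymm (le_of_forall_gt fun ε hε => ?_) zero_le
      obtain ⟨N, hN⟩ := exists_cap_iUnion_lt hsum hε
      refine (measure_mono fun x hx => ?_).trans_lt hN
      by_contra hxE
      exact hx (hlim N x hxE)
    have hF_int : ∫⁻ x, ∑' n, ‖((F : X →ₘ[m] ℝ) - G n : X →ₘ[m] ℝ) x‖ₑ ^ 2 ∂m ≠ ∞ := by
      rw [lintegral_tsum fun n => ((AEEqFun.aemeasurable _).enorm.pow_const 2)]
      refine ne_top_of_le_ne_top ?_
        (ENNReal.tsum_le_tsum fun n => le_self_add.trans (hFGsq n))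
      exact (summable_geometric_of_lt_one (by norm_num) (by norm_num)).tsum_ofReal_ne_top
    have hF_lim : ∀ᵐ x ∂m,
        Tendsto (fun n => ((F : X →ₘ[m] ℝ) - G n : X →ₘ[m] ℝ) x) atTop (𝓝 0) := by
      have hmeas : AEMeasurable
          (fun x => ∑' n, ‖((F : X →ₘ[m] ℝ) - G n : X →ₘ[m] ℝ) x‖ₑ ^ 2) m :=
        AEMeasurable.tsum fun n => (AEEqFun.aemeasurable _).enorm.pow_const 2
      filter_upwards [ae_lt_top' hmeas hF_int] with x hx
      have h2 := ENNReal.tendsto_atTop_zero_of_tsum_ne_top hx.ne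
      have h3 := (ENNReal.tendsto_toReal ENNReal.zero_ne_top).comp h2
      rw [tendsto_zero_iff_abs_tendsto_zero]
      have h4 := h3.sqrt
      refine (h4.congr fun n => ?_).trans (by simp)
      simp [Real.sqrt_sq_eq_abs]
    filter_upwards [hf_lim, hF_lim, ae_all_iff.2 hGg,
      ae_all_iff.2 fun n => AEEqFun.coeFn_sub (F : X →ₘ[m] ℝ) (G n)] with x h1 h2 h3 h4
    have h5 : Tendsto (fun n => (F : X →ₘ[m] ℝ) x - g n x) atTop (𝓝 0) :=
      h2.congr fun n => by rw [h4 n, Pi.sub_apply, h3 n]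
    exact (sub_eq_zero.1 (tendsto_nhds_unique (tendsto_const_nhds.sub h1) h5)).symm

/-! ### The spaces `L⁰(Cap)` and `QC(X)` -/

theorem proj_mk {f : X → ℝ} (hf : Measurable f) :
    proj m (L0Cap.mk m f hf) = AEEqFun.mk f hf.aestronglyMeasurable := rfl

theorem L0Cap.rep_ae_eq_proj (P : L0Cap m) : P.rep =ᵐ[m] proj m P := by
  conv_rhs => rw [← P.mk_rep, proj_mk]
  exact (AEEqFun.coeFn_mk _ _).symm

theorem isQuasiContinuous_rep (P : QC m) : IsQuasiContinuous m (P : L0Cap m).rep := by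
  obtain ⟨P, f, hf, hfq, rfl⟩ := P
  refine hfq.congr ?_
  rw [ae_iff]
  exact (L0Cap.mk_eq_mk_iff hf (L0Cap.measurable_rep _)).1 (L0Cap.mk_rep _).symm

theorem proj_injOn_QC : InjOn (proj m) (QC m : Set (L0Cap m)) := by
  intro P hP Q hQ h
  rw [← P.mk_rep, ← Q.mk_rep, L0Cap.mk_eq_mk_iff]
  have hae : P.rep =ᵐ[m] Q.rep := by
    refine P.rep_ae_eq_proj.trans ?_
    rw [h]
    exact Q.rep_ae_eq_proj.symm
  exact ae_iff.1
    ((isQuasiContinuous_rep ⟨P, hP⟩).ae_cap_eq (isQuasiContinuous_rep ⟨Q, hQ⟩) hae)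

end QCSobolev

open QCSobolev in
theorem mainTheorem3 {X : Type*} [MetricSpace X] [CompleteSpace X]
    [TopologicalSpace.SeparableSpace X] [MeasurableSpace X] [BorelSpace X] (m : Measure X)
    (hm : ∀ (x : X) (r : ℝ), m (Metric.ball x r) < ∞) (hdense : ContinuousDense m) :
    ∃ QCR : W12 m → QC m,
      (∀ F : W12 m, proj m (QCR F : L0Cap m) = (F : X →ₘ[m] ℝ)) ∧
      (∀ A : ℕ → Set X, IsExhaustion m A → ContinuousToQC A QCR) ∧
      (∀ A : ℕ → Set X, IsExhaustion m A → ∀ T : W12 m → QC m, ContinuousToQC A T →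
        (∀ F : W12 m, proj m (T F : L0Cap m) = (F : X →ₘ[m] ℝ)) → T = QCR) ∧
      IsLinearMap ℝ QCR ∧
      (∀ F : W12 m, ∀ᵐ x ∂(cap m),
        |(QCR F : L0Cap m).rep x| = (QCR (sobolevAbs F) : L0Cap m).rep x) ∧
      (∀ (f : ℕ → W12 m) (F : W12 m), Tendsto (fun n => sobolevNorm (f n - F)) atTop (𝓝 0) →
        ∀ φ : ℕ → ℕ, StrictMono φ → ∃ ψ : ℕ → ℕ, StrictMono ψ ∧
          TendstoQU m (fun n => (QCR (f (φ (ψ n))) : L0Cap m).rep) (QCR F : L0Cap m).rep) := by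
  choose q hqm hqc hqF using exists_quasiContinuous_rep hdense
  let Q : W12 m → QC m := fun F => ⟨L0Cap.mk m (q F) (hqm F), q F, hqm F, hqc F, rfl⟩
  have hQ : ∀ F : W12 m, proj m (Q F : L0Cap m) = (F : X →ₘ[m] ℝ) := fun F =>
    AEEqFun.ext ((AEEqFun.coeFn_mk _ _).trans (hqF F))
  have hrep : ∀ F : W12 m, (Q F : L0Cap m).rep =ᵐ[m] (F : X →ₘ[m] ℝ) := fun F => by
    have := (Q F : L0Cap m).rep_ae_eq_proj
    rwa [hQ F] at this
  have hext : ∀ P P' : QC m, proj m (P : L0Cap m) = proj m (P' : L0Cap m) → P = P' :=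
    fun P P' h => Subtype.ext (proj_injOn_QC P.2 P'.2 h)
  have hsubqc : ∀ G F : W12 m,
      IsQuasiContinuous m (fun x => (Q G : L0Cap m).rep x - (Q F : L0Cap m).rep x) := fun G F =>
    (isQuasiContinuous_rep _).sub (isQuasiContinuous_rep _)
  have hsub : ∀ G F : W12 m, (fun x => (Q G : L0Cap m).rep x - (Q F : L0Cap m).rep x) =ᵐ[m]
      ((G - F : W12 m) : X →ₘ[m] ℝ) := fun G F => by
    rw [Submodule.coe_sub]
    filter_upwards [hrep G, hrep F,
      AEEqFun.coeFn_sub (G : X →ₘ[m] ℝ) (F : X →ₘ[m] ℝ)] with x h1 h2 h3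
    rw [h3, Pi.sub_apply, h1, h2]
  refine ⟨Q, hQ, fun A _ F ε hε => ?_, fun A _ T _ hT => ?_, ⟨fun F G => ?_, fun c F => ?_⟩,
    fun F => ?_, fun f F hf φ hφ => ?_⟩
  · -- With `‖G - F‖² < c³`, the set `{c < |QCR G - QCR F|}` has capacity at most `4 c`.
    obtain ⟨c, hc, hcε⟩ : ∃ c : ℝ, 0 < c ∧ ENNReal.ofReal (10 * c) < ε := by
      have h0 : Tendsto (fun c : ℝ => ENNReal.ofReal (10 * c)) (𝓝[>] 0) (𝓝 0) := by
        have : Continuous fun c : ℝ => ENNReal.ofReal (10 * c) :=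
          ENNReal.continuous_ofReal.comp (continuous_const.mul continuous_id)
        simpa using (this.tendsto 0).mono_left nhdsWithin_le_nhds
      exact ((eventually_mem_nhdsWithin).and (h0.eventually_lt_const hε)).exists
    refine ⟨Real.sqrt (c ^ 3), by positivity, fun G hG => ?_⟩
    have hsq : sobolevNormSq m ((G - F : W12 m) : X →ₘ[m] ℝ) ≤ ENNReal.ofReal (c ^ 3) := by
      rw [sobolevNormSq_eq_ofReal]
      apply ENNReal.ofReal_le_ofReal
      rw [← Real.sq_sqrt (show 0 ≤ c ^ 3 by positivity)]
      exact pow_le_pow_left₀ (sobolevNorm_nonneg _) hG.le 2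
    refine (distQU_le A _ _ c).trans_lt (lt_of_le_of_lt ?_ hcε)
    calc 2 * (cap m {x | c < |(Q G : L0Cap m).rep x - (Q F : L0Cap m).rep x|} + ENNReal.ofReal c)
        ≤ 2 * (4 * (ENNReal.ofReal (c⁻¹ ^ 2) * ENNReal.ofReal (c ^ 3)) + ENNReal.ofReal c) := by
          gcongr
          refine (cap_lt_abs_le (hsubqc G F) (hsub G F) hc).trans ?_
          gcongr
      _ = 2 * (4 * ENNReal.ofReal c + ENNReal.ofReal c) := by
          rw [← ENNReal.ofReal_mul (by positivity)]
          congr 4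
          field_simp
      _ = ENNReal.ofReal (10 * c) := by
          rw [ENNReal.ofReal_mul (by norm_num), ENNReal.ofReal_ofNat]
          ring
  · funext F
    exact hext _ _ ((hT F).trans (hQ F).symm)
  · refine hext _ _ ?_
    rw [Submodule.coe_add, map_add, hQ, hQ, hQ, Submodule.coe_add]
  · refine hext _ _ ?_
    rw [Submodule.coe_smul, map_smul, hQ, hQ, Submodule.coe_smul]
  · refine ((isQuasiContinuous_rep _).comp_continuous continuous_abs).ae_cap_eq
      (isQuasiContinuous_rep _) ?_
    filter_upwards [hrep F, hrep (sobolevAbs F),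
      AEEqFun.coeFn_abs (F : X →ₘ[m] ℝ)] with x h1 h2 h3
    rw [h1, h2]
    exact h3.symm
  · -- Pass to a subsequence converging geometrically and remove a tail of exceptional sets.
    obtain ⟨ψ, hψ, hψF⟩ := extraction_forall_of_eventually'
      (P := fun n k => sobolevNorm (f (φ k) - F) < (1 / 4) ^ n) fun n =>
        (((hf.comp hφ.tendsto_atTop).eventually_lt_const
          (by positivity : (0 : ℝ) < (1 / 4) ^ n)).exists_forall_of_atTop)
    have hsq : ∀ n, sobolevNormSq m ((f (φ (ψ n)) - F : W12 m) : X →ₘ[m] ℝ) ≤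
        ENNReal.ofReal (1 * (1 / 16) ^ n) := fun n => by
      rw [sobolevNormSq_eq_ofReal]
      apply ENNReal.ofReal_le_ofReal
      calc sobolevNorm (f (φ (ψ n)) - F) ^ 2 ≤ ((1 / 4) ^ n) ^ 2 :=
            pow_le_pow_left₀ (sobolevNorm_nonneg _) (hψF n).le 2
        _ = 1 * (1 / 16) ^ n := by rw [one_mul, ← pow_mul, mul_comm, pow_mul]; norm_num
    have hsum := tsum_cap_lt_abs_ne_top (fun n => hsubqc (f (φ (ψ n))) F)
      (fun n => hsub (f (φ (ψ n))) F) hsq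
    refine ⟨ψ, hψ, fun B _ ε hε => ?_⟩
    obtain ⟨N, hN⟩ := exists_cap_iUnion_lt hsum hε
    refine ⟨_, hN, ?_⟩
    rw [Metric.tendstoUniformlyOn_iff]
    intro δ hδ
    filter_upwards [(tendsto_pow_atTop_nhds_zero_of_lt_one (by norm_num : (0 : ℝ) ≤ 1 / 2)
      (by norm_num)).eventually_lt_const hδ, eventually_ge_atTop N] with n hn hNn x hx
    have hxn : ¬ (1 / 2) ^ n < |(Q (f (φ (ψ n))) : L0Cap m).rep x - (Q F : L0Cap m).rep x| :=
      fun h => hx.2 (mem_iUnion.2 ⟨n - N, by rwa [Nat.sub_add_cancel hNn]⟩)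
    rw [dist_comm, Real.dist_eq]
    exact (not_lt.1 hxn).trans_lt hn
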